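/- Let $n\ge 0$ be an integer and let $B_n$ be the group of signed permutations, that is, of the permutations $w$ of $\{-n,\dots,-1,1,\dots,n\}$ such that $w(-i)=-w(i)$ for all $i$. Say that $w\in B_n$ avoids a pattern $\pi\in S_k$ if there are no $a_1<\cdots<a_k$ in $\{-n,\dots,-1,1,\dots,n\}$ such that, for all $i,j\in\{1,\dots,k\}$, $w(a_i)<w(a_j)$ if and only if $\pi(i)<\pi(j)$. For $0\le j\le n$ let $B_n^j(\pi)$ be the set of all $w\in B_n$ that avoid $\pi$ and satisfy $w(i)>0$ for exactly $j$ indices $i\in\{1,\dots,n\}$. Then, for all $0\le j\le n$, $$|B_n^j(1234)|=|B_n^j(2143)|.$$ -/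

import Mathlib

/-- The index set `{-n, …, -1, 1, …, n}`, linearly ordered as a subset of `ℤ`. -/
abbrev SignedIndex (n : ℕ) : Type := {i : ℤ // i ≠ 0 ∧ |i| ≤ (n : ℤ)}

/-- The reflection `i ↦ -i` of `{-n, …, -1, 1, …, n}`. -/
def SignedIndex.opp {n : ℕ} (i : SignedIndex n) : SignedIndex n :=
  ⟨-i.1, neg_ne_zero.mpr i.2.1, (abs_neg i.1).le.trans i.2.2⟩

/-- The signed permutation group `B_n`: the permutations `w` of `{-n, …, -1, 1, …, n}` with
`w (-i) = - w i` for all `i`. -/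
def signedPerms (n : ℕ) : Subgroup (Equiv.Perm (SignedIndex n)) where
  carrier := {w | ∀ i, w i.opp = (w i).opp}
  one_mem' := fun _ => rfl
  mul_mem' := by
    intro v w hv hw i
    rw [Equiv.Perm.mul_apply, Equiv.Perm.mul_apply, hw, hv]
  inv_mem' := by
    intro w hw i
    have h : w (w⁻¹ i) = i := w.apply_symm_apply i
    rw [Equiv.Perm.inv_eq_iff_eq, hw, h]

/-- A permutation `w` of a linearly ordered set avoids the pattern `π ∈ S_k` if there are no
`a_1 < ⋯ < a_k` such that `w a_1, …, w a_k` are in the same relative order as `π 1, …, π k`.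
For the set `{1, …, m}` this is avoidance in `S_m`; for `{-n, …, -1, 1, …, n}` it is avoidance by
the image in `S_{2n}` under the order-preserving relabelling of this set by `{1, …, 2n}`. -/
def AvoidsPattern {α : Type*} [LinearOrder α] {k : ℕ} (w : Equiv.Perm α)
    (π : Equiv.Perm (Fin k)) : Prop :=
  ¬ ∃ a : Fin k → α, StrictMono a ∧ ∀ i j, w (a i) < w (a j) ↔ π i < π j

/-- The pattern 1234 (on the letters `0, 1, 2, 3`). -/
def pattern1234 : Equiv.Perm (Fin 4) := Equiv.refl (Fin 4)

/-- The pattern 2143 (on the letters `0, 1, 2, 3`). -/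
def pattern2143 : Equiv.Perm (Fin 4) where
  toFun := ![1, 0, 3, 2]
  invFun := ![1, 0, 3, 2]
  left_inv := by decide
  right_inv := by decide

/-- The number of indices `i ∈ {1, …, n}` with `w i > 0`. -/
noncomputable def numPosPos {n : ℕ} (w : Equiv.Perm (SignedIndex n)) : ℕ :=
  {i : SignedIndex n | 0 < i.1 ∧ 0 < (w i).1}.ncard

/-- The set `B_n^j(π)`: the signed permutations in `B_n` that avoid `π` and have exactly `j`
indices `i ∈ {1, …, n}` with positive image. -/
def avoidingSignedPerms (n j : ℕ) {k : ℕ} (π : Equiv.Perm (Fin k)) :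
    Set (Equiv.Perm (SignedIndex n)) :=
  {w | w ∈ signedPerms n ∧ AvoidsPattern w π ∧ numPosPos w = j}

/-! The graph of a signed permutation is invariant under the half-turn about the origin, and so are
increasing and decreasing pairs. Write `α` for 12 or 21. If `w` avoids `α ⊕ α`, its north-east
quadrant has no `α`-pair, since such a pair together with its half-turn image in the south-west
quadrant would form the pattern. So that quadrant is monotone, and its rows and columns determine
it. Nothing is lost, then, by keeping only the north-west quadrant and collapsing the south-west
quadrant onto the row `0` and the north-east one onto the column `0`. This `flatten` is a bijection
from the avoiders with `j` points in the north-east quadrant to the fillings with `n + j` points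
that avoid `α ⊕ α` (`ncard_avoidingSignedPerms_eq`).

For fillings, 12 can be traded for 21 in front of any `β`. The cells with a `β`-pair to the
north-east form a set closed to the south-west, and avoiding `12 ⊕ β` or `21 ⊕ β` is a condition on
that set alone. Given the points outside, the set has exactly one filling of each kind. Refilling
keeps the set itself, because every cell of it sees a `β`-pair lying outside it. This gives
`ncard_avoidingFillings_asc_eq_desc`.

Reflection in the antidiagonal exchanges the two summands, so the chain `12 ⊕ 12`, `21 ⊕ 12`, `12 ⊕
21`, `21 ⊕ 21` proves the theorem. -/

/-- `q` lies strictly to the north-east of `p`. -/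
def Asc (p q : ℤ × ℤ) : Prop := p.1 < q.1 ∧ p.2 < q.2

/-- `q` lies strictly to the south-east of `p`. -/
def Desc (p q : ℤ × ℤ) : Prop := p.1 < q.1 ∧ q.2 < p.2

/-- Finite point sets in `[-n, 0] × [0, n]`, without the corner `(0, 0)`, that have exactly one
point in each column `x < 0` and exactly one point in each row `y > 0`. -/
structure IsFilling (n : ℕ) (S : Finset (ℤ × ℤ)) : Prop where
  box : ∀ p ∈ S, -(n : ℤ) ≤ p.1 ∧ p.1 ≤ 0 ∧ 0 ≤ p.2 ∧ p.2 ≤ n ∧ p ≠ (0, 0)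
  col : ∀ x : ℤ, -(n : ℤ) ≤ x → x < 0 → ∃! y, (x, y) ∈ S
  row : ∀ y : ℤ, 0 < y → y ≤ n → ∃! x, (x, y) ∈ S

/-- The fillings with `n + j` points. -/
def fillings (n j : ℕ) : Set (Finset (ℤ × ℤ)) := {S | IsFilling n S ∧ S.card = n + j}

/-- `S` contains an `α`-pair to the south-west of a `β`-pair. -/
def ContainsSum (α β : ℤ × ℤ → ℤ × ℤ → Prop) (S : Finset (ℤ × ℤ)) : Prop :=
  ∃ p ∈ S, ∃ q ∈ S, ∃ r ∈ S, ∃ s ∈ S,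
    α p q ∧ β r s ∧ Asc p r ∧ Asc p s ∧ Asc q r ∧ Asc q s

/-- The fillings with `n + j` points that avoid the direct sum of `α` and `β`. -/
def avoidingFillings (n j : ℕ) (α β : ℤ × ℤ → ℤ × ℤ → Prop) : Set (Finset (ℤ × ℤ)) :=
  {S | S ∈ fillings n j ∧ ¬ ContainsSum α β S}

/-- The cells with a `β`-pair of points of `S` to the north-east. -/
def shade (β : ℤ × ℤ → ℤ × ℤ → Prop) (S : Finset (ℤ × ℤ)) : Set (ℤ × ℤ) :=
  {c | ∃ p ∈ S, ∃ q ∈ S, β p q ∧ Asc c p ∧ Asc c q}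

theorem IsFilling.col_unique {n : ℕ} {S : Finset (ℤ × ℤ)} (h : IsFilling n S) {x y z : ℤ}
    (hx : x < 0) (hy : (x, y) ∈ S) (hz : (x, z) ∈ S) : y = z :=
  (h.col x (h.box _ hy).1 hx).unique hy hz

theorem IsFilling.row_unique {n : ℕ} {S : Finset (ℤ × ℤ)} (h : IsFilling n S) {x z y : ℤ}
    (hy : 0 < y) (hx : (x, y) ∈ S) (hz : (z, y) ∈ S) : x = z :=
  (h.row y hy (h.box _ hx).2.2.2.1).unique hx hz

theorem finite_fillings (n j : ℕ) : (fillings n j).Finite := by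
  refine ((Finset.Icc (-(n : ℤ)) 0 ×ˢ Finset.Icc (0 : ℤ) n).powerset.finite_toSet).subset ?_
  intro S hS
  simp only [Finset.coe_powerset, Set.mem_preimage, Set.mem_powerset_iff, Finset.coe_subset]
  intro p hp
  have := hS.1.box p hp
  simp only [Finset.mem_product, Finset.mem_Icc]
  omega

/-! ### Column exchanges and the moment. -/

/-- Exchange the columns `a` and `b`. -/
def swapColumns (a b : ℤ) (S : Finset (ℤ × ℤ)) : Finset (ℤ × ℤ) :=
  S.map ((Equiv.swap a b).prodCongr (Equiv.refl ℤ)).toEmbedding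

theorem mem_swapColumns {a b x y : ℤ} {S : Finset (ℤ × ℤ)} :
    (x, y) ∈ swapColumns a b S ↔ (Equiv.swap a b x, y) ∈ S := by
  simp [swapColumns, Finset.mem_map_equiv]

theorem swap_range {n : ℕ} {a b : ℤ} (ha : -(n : ℤ) ≤ a) (ha' : a < 0) (hb : -(n : ℤ) ≤ b)
    (hb' : b < 0) (x : ℤ) :
    (-(n : ℤ) ≤ Equiv.swap a b x ↔ -(n : ℤ) ≤ x) ∧ (Equiv.swap a b x < 0 ↔ x < 0) ∧
    (Equiv.swap a b x ≤ 0 ↔ x ≤ 0) := by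
  rw [Equiv.swap_apply_def]
  split_ifs <;> omega

theorem IsFilling.swapColumns {n : ℕ} {S : Finset (ℤ × ℤ)} (h : IsFilling n S) {a b : ℤ}
    (ha : -(n : ℤ) ≤ a) (ha' : a < 0) (hb : -(n : ℤ) ≤ b) (hb' : b < 0) :
    IsFilling n (swapColumns a b S) := by
  have hr := swap_range ha ha' hb hb'
  constructor
  · rintro ⟨x, y⟩ hp
    rw [mem_swapColumns] at hp
    have := h.box _ hp
    have := hr x
    simp only [ne_eq, Prod.mk.injEq] at *
    omega
  · intro x hx hx'
    simp only [mem_swapColumns]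
    exact h.col _ ((hr x).1.2 hx) ((hr x).2.1.2 hx')
  · intro y hy hy'
    obtain ⟨x, hx, hu⟩ := h.row y hy hy'
    refine ⟨Equiv.swap a b x, by simpa [mem_swapColumns] using hx, ?_⟩
    intro z hz
    rw [mem_swapColumns] at hz
    rw [← hu _ hz, Equiv.swap_apply_self]

theorem swapColumns_mem_fillings {n j : ℕ} {S : Finset (ℤ × ℤ)} (h : S ∈ fillings n j)
    {p q : ℤ × ℤ} (hp : p ∈ S) (hq : q ∈ S) (hp' : p.1 < 0) (hq' : q.1 < 0) :
    swapColumns p.1 q.1 S ∈ fillings n j :=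
  ⟨h.1.swapColumns (h.1.box p hp).1 hp' (h.1.box q hq).1 hq', by
    rw [swapColumns, Finset.card_map, h.2]⟩

/-- A negative column holds a single point, so the exchange affects only the four corners of the
rectangle spanned by `p` and `q`. -/
theorem mem_swapColumns_iff_of_notMem {n : ℕ} {S : Finset (ℤ × ℤ)} (h : IsFilling n S)
    {Λ : Set (ℤ × ℤ)} {p q : ℤ × ℤ} (hp : p ∈ S) (hq : q ∈ S) (hp' : p.1 < 0) (hq' : q.1 < 0)
    (h1 : p ∈ Λ) (h2 : q ∈ Λ) (h3 : (p.1, q.2) ∈ Λ) (h4 : (q.1, p.2) ∈ Λ) :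
    ∀ c ∉ Λ, (c ∈ swapColumns p.1 q.1 S ↔ c ∈ S) := by
  rintro ⟨x, y⟩ hc
  rw [mem_swapColumns]
  by_cases hx : x = p.1
  · subst hx
    rw [Equiv.swap_apply_left]
    constructor
    · intro hm
      have := h.col_unique hq' hm hq
      subst this
      exact absurd h3 hc
    · intro hm
      have := h.col_unique hp' hm hp
      subst this
      exact absurd h1 hc
  by_cases hx' : x = q.1
  · subst hx'
    rw [Equiv.swap_apply_right]
    constructor
    · intro hm
      have := h.col_unique hp' hm hp
      subst this
      exact absurd h4 hc
    · intro hm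
      have := h.col_unique hq' hm hq
      subst this
      exact absurd h2 hc
  rw [Equiv.swap_apply_of_ne_of_ne hx hx']

/-- The moment `∑ x * y` of a point set. -/
def moment (S : Finset (ℤ × ℤ)) : ℤ := ∑ r ∈ S, r.1 * r.2

theorem moment_swapColumns {n : ℕ} {S : Finset (ℤ × ℤ)} (h : IsFilling n S)
    {p q : ℤ × ℤ} (hp : p ∈ S) (hq : q ∈ S) (hpq : p.1 ≠ q.1) (hp' : p.1 < 0) (hq' : q.1 < 0) :
    moment (swapColumns p.1 q.1 S) = moment S - (q.1 - p.1) * (q.2 - p.2) := by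
  have hne : q ≠ p := fun e => hpq (by rw [e])
  have hq2 : q ∈ S.erase p := Finset.mem_erase.2 ⟨hne, hq⟩
  unfold moment swapColumns
  rw [Finset.sum_map, ← Finset.add_sum_erase S _ hp, ← Finset.add_sum_erase _ _ hq2,
    ← Finset.add_sum_erase S _ hp, ← Finset.add_sum_erase _ _ hq2]
  have : ∀ r ∈ (S.erase p).erase q,
      (((Equiv.swap p.1 q.1).prodCongr (Equiv.refl ℤ)).toEmbedding r).1 *
      (((Equiv.swap p.1 q.1).prodCongr (Equiv.refl ℤ)).toEmbedding r).2 = r.1 * r.2 := by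
    rintro ⟨x, y⟩ hr
    simp only [Finset.mem_erase] at hr
    have h1 : x ≠ p.1 := fun e => by
      subst e
      exact hr.2.1 (Prod.ext rfl (h.col_unique hp' hr.2.2 hp))
    have h2 : x ≠ q.1 := fun e => by
      subst e
      exact hr.1 (Prod.ext rfl (h.col_unique hq' hr.2.2 hq))
    simp [Equiv.swap_apply_of_ne_of_ne h1 h2]
  rw [Finset.sum_congr rfl this]
  simp
  ring

/-! ### Existence and uniqueness of refillings of a region closed to the south-west. -/

section Refill

variable {n j : ℕ} {Λ : Set (ℤ × ℤ)}

theorem exists_refill_not_asc (hneg : ∀ c ∈ Λ, c.1 < 0)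
    (hlow : ∀ c ∈ Λ, ∀ d : ℤ × ℤ, d.1 ≤ c.1 → d.2 ≤ c.2 → d ∈ Λ)
    {S : Finset (ℤ × ℤ)} (hS : S ∈ fillings n j) :
    ∃ T ∈ fillings n j, (∀ c ∉ Λ, (c ∈ T ↔ c ∈ S)) ∧
      ∀ p ∈ T, ∀ q ∈ T, Asc p q → q ∉ Λ := by
  -- Exchanging the columns of an ascending pair inside `Λ` lowers the moment, so a refilling of
  -- least moment has no such pair.
  obtain ⟨T, hT, hmin⟩ := Set.exists_min_image
    {T | T ∈ fillings n j ∧ ∀ c ∉ Λ, (c ∈ T ↔ c ∈ S)} moment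
    ((finite_fillings n j).subset fun T hT => hT.1) ⟨S, hS, fun _ _ => Iff.rfl⟩
  refine ⟨T, hT.1, hT.2, ?_⟩
  rintro p hp q hq ⟨h1, h2⟩ hqL
  have hq' := hneg q hqL
  have hp' : p.1 < 0 := h1.trans hq'
  have := hmin (swapColumns p.1 q.1 T)
    ⟨swapColumns_mem_fillings hT.1 hp hq hp' hq', fun c hc =>
      (mem_swapColumns_iff_of_notMem hT.1.1 hp hq hp' hq' (hlow q hqL _ h1.le h2.le) hqL
        (hlow q hqL _ h1.le le_rfl) (hlow q hqL _ le_rfl h2.le) c hc).trans (hT.2 c hc)⟩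
  rw [moment_swapColumns hT.1.1 hp hq h1.ne hp' hq'] at this
  nlinarith [mul_pos (sub_pos.2 h1) (sub_pos.2 h2)]

theorem exists_refill_not_desc (hneg : ∀ c ∈ Λ, c.1 < 0)
    (hlow : ∀ c ∈ Λ, ∀ d : ℤ × ℤ, d.1 ≤ c.1 → d.2 ≤ c.2 → d ∈ Λ)
    {S : Finset (ℤ × ℤ)} (hS : S ∈ fillings n j) :
    ∃ T ∈ fillings n j, (∀ c ∉ Λ, (c ∈ T ↔ c ∈ S)) ∧
      ∀ p ∈ T, ∀ q ∈ T, Desc p q → (q.1, p.2) ∉ Λ := by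
  -- Exchanging the columns of a descending pair raises the moment; the north-east corner of its
  -- rectangle being in `Λ` puts all four corners there.
  obtain ⟨T, hT, hmax⟩ := Set.exists_max_image
    {T | T ∈ fillings n j ∧ ∀ c ∉ Λ, (c ∈ T ↔ c ∈ S)} moment
    ((finite_fillings n j).subset fun T hT => hT.1) ⟨S, hS, fun _ _ => Iff.rfl⟩
  refine ⟨T, hT.1, hT.2, ?_⟩
  rintro p hp q hq ⟨h1, h2⟩ hqL
  have hq' : q.1 < 0 := hneg (q.1, p.2) hqL
  have hp' : p.1 < 0 := h1.trans hq'
  have := hmax (swapColumns p.1 q.1 T)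
    ⟨swapColumns_mem_fillings hT.1 hp hq hp' hq', fun c hc =>
      (mem_swapColumns_iff_of_notMem hT.1.1 hp hq hp' hq' (hlow _ hqL _ h1.le le_rfl)
        (hlow _ hqL _ le_rfl h2.le) (hlow _ hqL _ h1.le h2.le) hqL c hc).trans (hT.2 c hc)⟩
  rw [moment_swapColumns hT.1.1 hp hq h1.ne hp' hq'] at this
  nlinarith [mul_pos (sub_pos.2 h1) (sub_pos.2 h2)]

theorem subset_of_forall_neg {S T : Finset (ℤ × ℤ)}
    (hneg : ∀ c ∈ Λ, c.1 < 0) (hST : ∀ c ∉ Λ, (c ∈ T ↔ c ∈ S))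
    (h : ∀ x : ℤ, x < 0 → ∀ y, (x, y) ∈ S → (x, y) ∈ T) : S ⊆ T := by
  rintro ⟨x, y⟩ hp
  rcases lt_or_ge x 0 with hx | hx
  · exact h x hx y hp
  · exact (hST _ fun hc => absurd (hneg _ hc) (not_lt.2 hx)).2 hp

/-- The filling is forced column by column from the left. In the leftmost column where two fillings
differ, the one with the lower point has its point of the higher row further right; this is an
ascent, so that point lies outside `Λ` and is shared, giving the other filling two points in that
row. -/
theorem refill_not_asc_unique (hneg : ∀ c ∈ Λ, c.1 < 0)
    {S T : Finset (ℤ × ℤ)} (hS : IsFilling n S) (hT : IsFilling n T)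
    (hST : ∀ c ∉ Λ, (c ∈ S ↔ c ∈ T))
    (hSa : ∀ p ∈ S, ∀ q ∈ S, Asc p q → q ∉ Λ) (hTa : ∀ p ∈ T, ∀ q ∈ T, Asc p q → q ∉ Λ) :
    S = T := by
  have key : ∀ {S T : Finset (ℤ × ℤ)}, IsFilling n S → IsFilling n T →
      (∀ c ∉ Λ, (c ∈ S ↔ c ∈ T)) → (∀ p ∈ S, ∀ q ∈ S, Asc p q → q ∉ Λ) → ∀ x : ℤ,
      (∀ z < x, ∀ y, (z, y) ∈ S → (z, y) ∈ T) → x < 0 →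
      ∀ y y', (x, y) ∈ S → (x, y') ∈ T → ¬ y < y' := by
    intro S T hS hT hST hSa x ih hx y y' hy hy' hlt
    have hy0 : 0 < y' := lt_of_le_of_lt (hS.box _ hy).2.2.1 hlt
    obtain ⟨z, hz, -⟩ := hS.row y' hy0 (hT.box _ hy').2.2.2.1
    rcases lt_trichotomy z x with h | h | h
    · exact h.ne (hT.row_unique hy0 (ih z h _ hz) hy')
    · subst h
      exact hlt.ne (hS.col_unique hx hy hz)
    · refine h.ne' (hT.row_unique hy0 ((hST _ ?_).1 hz) hy')
      exact hSa _ hy _ hz ⟨h, hlt⟩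
  have main : ∀ (k : ℕ) (x : ℤ), x ≤ -(n : ℤ) + k → x < 0 →
      ∀ y, ((x, y) ∈ S ↔ (x, y) ∈ T) := by
    intro k
    induction k using Nat.strong_induction_on with
    | _ k ih =>
      intro x hxk hx
      by_cases hxn : -(n : ℤ) ≤ x
      · have ih' : ∀ z < x, ∀ y, ((z, y) ∈ S ↔ (z, y) ∈ T) := by
          intro z hz y
          by_cases hzn : -(n : ℤ) ≤ z
          · exact ih (z + n).toNat (by omega) z (by omega) (by omega) y
          · exact ⟨fun h => absurd (hS.box _ h).1 hzn, fun h => absurd (hT.box _ h).1 hzn⟩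
        obtain ⟨y₁, h₁, -⟩ := hS.col x hxn hx
        obtain ⟨y₂, h₂, -⟩ := hT.col x hxn hx
        have a := key hS hT hST hSa x (fun z hz y => (ih' z hz y).1) hx y₁ y₂ h₁ h₂
        have b := key hT hS (fun c hc => (hST c hc).symm) hTa x
          (fun z hz y => (ih' z hz y).2) hx y₂ y₁ h₂ h₁
        have e : y₁ = y₂ := by omega
        subst e
        intro y
        exact ⟨fun h => hS.col_unique hx h h₁ ▸ h₂, fun h => hT.col_unique hx h h₂ ▸ h₁⟩
      · intro y
        exact ⟨fun h => absurd (hS.box _ h).1 hxn, fun h => absurd (hT.box _ h).1 hxn⟩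
  refine subset_antisymm ?_ ?_
  · exact subset_of_forall_neg hneg (fun c hc => (hST c hc).symm)
      fun x hx y h => (main (x + n).toNat x (by omega) hx y).1 h
  · exact subset_of_forall_neg hneg hST
      fun x hx y h => (main (x + n).toNat x (by omega) hx y).2 h

/-- Here the columns are forced from the right, starting from column `0`, which `Λ` does not meet.
-/
theorem refill_not_desc_unique (hneg : ∀ c ∈ Λ, c.1 < 0)
    {S T : Finset (ℤ × ℤ)} (hS : IsFilling n S) (hT : IsFilling n T)
    (hST : ∀ c ∉ Λ, (c ∈ S ↔ c ∈ T))
    (hSa : ∀ p ∈ S, ∀ q ∈ S, Desc p q → (q.1, p.2) ∉ Λ)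
    (hTa : ∀ p ∈ T, ∀ q ∈ T, Desc p q → (q.1, p.2) ∉ Λ) :
    S = T := by
  have key : ∀ {S T : Finset (ℤ × ℤ)}, IsFilling n S → IsFilling n T →
      (∀ c ∉ Λ, (c ∈ S ↔ c ∈ T)) →
      (∀ p ∈ S, ∀ q ∈ S, Desc p q → (q.1, p.2) ∉ Λ) → ∀ x : ℤ,
      (∀ z > x, z < 0 → ∀ y, (z, y) ∈ S → (z, y) ∈ T) → x < 0 →
      ∀ y y', (x, y) ∈ S → (x, y') ∈ T → ¬ y < y' := by
    intro S T hS hT hST hSa x ih hx y y' hy hy' hlt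
    have hy0 : 0 < y' := lt_of_le_of_lt (hS.box _ hy).2.2.1 hlt
    obtain ⟨z, hz, -⟩ := hS.row y' hy0 (hT.box _ hy').2.2.2.1
    rcases lt_trichotomy z x with h | h | h
    -- The corner `(x, y')` of this descent lies outside `Λ` and carries a point of `T`, hence also
    -- one of `S`, a second point in column `x`.
    · have hn := hSa _ hz _ hy ⟨h, hlt⟩
      exact hlt.ne (hS.col_unique hx hy ((hST _ hn).2 hy'))
    · subst h
      exact hlt.ne (hS.col_unique hx hy hz)
    · refine h.ne' (hT.row_unique hy0 ?_ hy')
      by_cases hz0 : z < 0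
      · exact ih z h hz0 _ hz
      · exact (hST _ fun hc => hz0 (hneg _ hc)).1 hz
  have main : ∀ (k : ℕ) (x : ℤ), -(k : ℤ) ≤ x → x < 0 →
      ∀ y, ((x, y) ∈ S ↔ (x, y) ∈ T) := by
    intro k
    induction k using Nat.strong_induction_on with
    | _ k ih =>
      intro x hxk hx
      by_cases hxn : -(n : ℤ) ≤ x
      · have ih' : ∀ z > x, z < 0 → ∀ y, ((z, y) ∈ S ↔ (z, y) ∈ T) := by
          intro z hz hz0 y
          exact ih (-z).toNat (by omega) z (by omega) (by omega) y
        obtain ⟨y₁, h₁, -⟩ := hS.col x hxn hx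
        obtain ⟨y₂, h₂, -⟩ := hT.col x hxn hx
        have a := key hS hT hST hSa x (fun z hz hz0 y => (ih' z hz hz0 y).1) hx y₁ y₂ h₁ h₂
        have b := key hT hS (fun c hc => (hST c hc).symm) hTa x
          (fun z hz hz0 y => (ih' z hz hz0 y).2) hx y₂ y₁ h₂ h₁
        have e : y₁ = y₂ := by omega
        subst e
        intro y
        exact ⟨fun h => hS.col_unique hx h h₁ ▸ h₂, fun h => hT.col_unique hx h h₂ ▸ h₁⟩
      · intro y
        exact ⟨fun h => absurd (hS.box _ h).1 hxn, fun h => absurd (hT.box _ h).1 hxn⟩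
  refine subset_antisymm ?_ ?_
  · exact subset_of_forall_neg hneg (fun c hc => (hST c hc).symm)
      fun x hx y h => (main (-x).toNat x (by omega) hx y).1 h
  · exact subset_of_forall_neg hneg hST
      fun x hx y h => (main (-x).toNat x (by omega) hx y).2 h

end Refill

/-! ### The shade of `β`, and trading 12 for 21. -/

section Shade

variable {n j : ℕ} {β : ℤ × ℤ → ℤ × ℤ → Prop} {S T : Finset (ℤ × ℤ)}

theorem shade_neg (hS : IsFilling n S) : ∀ c ∈ shade β S, c.1 < 0 := by
  rintro c ⟨p, hp, q, hq, -, h, -⟩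
  exact h.1.trans_le (hS.box p hp).2.1

theorem shade_lower :
    ∀ c ∈ shade β S, ∀ d : ℤ × ℤ, d.1 ≤ c.1 → d.2 ≤ c.2 → d ∈ shade β S := by
  rintro c ⟨p, hp, q, hq, hb, h, h'⟩ d h1 h2
  exact ⟨p, hp, q, hq, hb, ⟨h1.trans_lt h.1, h2.trans_lt h.2⟩, h1.trans_lt h'.1, h2.trans_lt h'.2⟩

/-- If a point of the pair is itself shaded, it can replace `c`; this moves strictly north-east
within the box, so the process stops. -/
theorem exists_pair_outside_shade (hS : IsFilling n S) {c : ℤ × ℤ} (hc : c ∈ shade β S) :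
    ∃ p ∈ S, ∃ q ∈ S, β p q ∧ Asc c p ∧ Asc c q ∧ p ∉ shade β S ∧ q ∉ shade β S := by
  induction hk : (n - c.1 - c.2).toNat using Nat.strong_induction_on generalizing c with
  | _ k ih =>
    have step : ∀ d ∈ shade β S, Asc c d →
        ∃ p ∈ S, ∃ q ∈ S, β p q ∧ Asc c p ∧ Asc c q ∧ p ∉ shade β S ∧ q ∉ shade β S := by
      intro d hd hcd
      have hlt : (n - d.1 - d.2).toNat < k := by
        obtain ⟨p, hp, -, -, -, h, -⟩ := hd
        have := hS.box p hp
        unfold Asc at *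
        omega
      obtain ⟨p, hp, q, hq, hb, h1, h2, h3⟩ := ih _ hlt hd rfl
      exact ⟨p, hp, q, hq, hb, ⟨hcd.1.trans h1.1, hcd.2.trans h1.2⟩,
        ⟨hcd.1.trans h2.1, hcd.2.trans h2.2⟩, h3⟩
    obtain ⟨p, hp, q, hq, hb, h1, h2⟩ := id hc
    by_cases hpL : p ∈ shade β S
    · exact step p hpL h1
    by_cases hqL : q ∈ shade β S
    · exact step q hqL h2
    exact ⟨p, hp, q, hq, hb, h1, h2, hpL, hqL⟩

theorem shade_eq_of_agree (hS : IsFilling n S) (h : ∀ c ∉ shade β S, (c ∈ T ↔ c ∈ S)) :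
    shade β T = shade β S := by
  ext c
  constructor
  · rintro ⟨p, hp, q, hq, hb, h1, h2⟩
    by_cases hpL : p ∈ shade β S
    · exact shade_lower p hpL c h1.1.le h1.2.le
    by_cases hqL : q ∈ shade β S
    · exact shade_lower q hqL c h2.1.le h2.2.le
    exact ⟨p, (h p hpL).1 hp, q, (h q hqL).1 hq, hb, h1, h2⟩
  · intro hc
    obtain ⟨p, hp, q, hq, hb, h1, h2, h3, h4⟩ := exists_pair_outside_shade hS hc
    exact ⟨p, (h p h3).2 hp, q, (h q h4).2 hq, hb, h1, h2⟩

theorem not_containsSum_asc :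
    ¬ ContainsSum Asc β S ↔ ∀ p ∈ S, ∀ q ∈ S, Asc p q → q ∉ shade β S := by
  constructor
  · rintro h p hp q hq hpq ⟨r, hr, s, hs, hb, h1, h2⟩
    exact h ⟨p, hp, q, hq, r, hr, s, hs, hpq, hb, ⟨hpq.1.trans h1.1, hpq.2.trans h1.2⟩,
      ⟨hpq.1.trans h2.1, hpq.2.trans h2.2⟩, h1, h2⟩
  · rintro h ⟨p, hp, q, hq, r, hr, s, hs, ha, hb, -, -, h1, h2⟩
    exact h p hp q hq ha ⟨r, hr, s, hs, hb, h1, h2⟩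

/-- Being south-west of a point means the same for both points of a descent as for the north-east
corner of their rectangle. -/
theorem not_containsSum_desc :
    ¬ ContainsSum Desc β S ↔ ∀ p ∈ S, ∀ q ∈ S, Desc p q → (q.1, p.2) ∉ shade β S := by
  constructor
  · rintro h p hp q hq hpq ⟨r, hr, s, hs, hb, h1, h2⟩
    exact h ⟨p, hp, q, hq, r, hr, s, hs, hpq, hb, ⟨hpq.1.trans h1.1, h1.2⟩,
      ⟨hpq.1.trans h2.1, h2.2⟩, ⟨h1.1, hpq.2.trans h1.2⟩, ⟨h2.1, hpq.2.trans h2.2⟩⟩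
  · rintro h ⟨p, hp, q, hq, r, hr, s, hs, ha, hb, h1, h2, h3, h4⟩
    exact h p hp q hq ha ⟨r, hr, s, hs, hb, ⟨h3.1, h1.2⟩, ⟨h4.1, h2.2⟩⟩

variable (n j β)

/-- Refilling the shade turns avoidance of `12 ⊕ β` into avoidance of `21 ⊕ β`. -/
theorem ncard_avoidingFillings_asc_eq_desc :
    (avoidingFillings n j Asc β).ncard = (avoidingFillings n j Desc β).ncard := by
  have hfin : ∀ α, (avoidingFillings n j α β).Finite := fun α =>
    (finite_fillings n j).subset fun S hS => hS.1
  apply le_antisymm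
  · have h : ∀ S : Finset (ℤ × ℤ), ∃ T, S ∈ avoidingFillings n j Asc β →
        T ∈ avoidingFillings n j Desc β ∧ (∀ c ∉ shade β S, (c ∈ T ↔ c ∈ S)) ∧
        shade β T = shade β S := by
      intro S
      by_cases hS : S ∈ avoidingFillings n j Asc β
      · obtain ⟨T, hT, h1, h2⟩ := exists_refill_not_desc (shade_neg hS.1.1) shade_lower hS.1
        have e := shade_eq_of_agree hS.1.1 h1
        refine ⟨T, fun _ => ⟨⟨hT, ?_⟩, h1, e⟩⟩
        rw [not_containsSum_desc, e]
        exact h2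
      · exact ⟨S, fun h => absurd h hS⟩
    choose f hf using h
    -- Equal images have the same shade, so the two sources agree outside it, and uniqueness of the
    -- refilling applies.
    refine Set.ncard_le_ncard_of_injOn f (fun S hS => (hf S hS).1) ?_ (hfin _)
    intro S hS S' hS' e
    obtain ⟨-, h1, h2⟩ := hf S hS
    obtain ⟨-, h1', h2'⟩ := hf S' hS'
    have e2 : shade β S' = shade β S := by rw [← h2, ← h2', e]
    refine refill_not_asc_unique (shade_neg hS.1.1) hS.1.1 hS'.1.1 (fun c hc => ?_)
      (not_containsSum_asc.1 hS.2) (e2 ▸ not_containsSum_asc.1 hS'.2)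
    rw [← h1 c hc, ← h1' c (e2 ▸ hc), e]
  · have h : ∀ S : Finset (ℤ × ℤ), ∃ T, S ∈ avoidingFillings n j Desc β →
        T ∈ avoidingFillings n j Asc β ∧ (∀ c ∉ shade β S, (c ∈ T ↔ c ∈ S)) ∧
        shade β T = shade β S := by
      intro S
      by_cases hS : S ∈ avoidingFillings n j Desc β
      · obtain ⟨T, hT, h1, h2⟩ := exists_refill_not_asc (shade_neg hS.1.1) shade_lower hS.1
        have e := shade_eq_of_agree hS.1.1 h1
        refine ⟨T, fun _ => ⟨⟨hT, ?_⟩, h1, e⟩⟩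
        rw [not_containsSum_asc, e]
        exact h2
      · exact ⟨S, fun h => absurd h hS⟩
    choose f hf using h
    refine Set.ncard_le_ncard_of_injOn f (fun S hS => (hf S hS).1) ?_ (hfin _)
    intro S hS S' hS' e
    obtain ⟨-, h1, h2⟩ := hf S hS
    obtain ⟨-, h1', h2'⟩ := hf S' hS'
    have e2 : shade β S' = shade β S := by rw [← h2, ← h2', e]
    refine refill_not_desc_unique (shade_neg hS.1.1) hS.1.1 hS'.1.1 (fun c hc => ?_)
      (not_containsSum_desc.1 hS.2) (e2 ▸ not_containsSum_desc.1 hS'.2)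
    rw [← h1 c hc, ← h1' c (e2 ▸ hc), e]

end Shade

/-! ### Reflection in the antidiagonal. -/

/-- Reflection `(x, y) ↦ (-y, -x)` in the antidiagonal. -/
def antiEquiv : ℤ × ℤ ≃ ℤ × ℤ where
  toFun p := (-p.2, -p.1)
  invFun p := (-p.2, -p.1)
  left_inv p := by simp
  right_inv p := by simp

/-- The reflection of a point set in the antidiagonal. -/
def antiReflect (S : Finset (ℤ × ℤ)) : Finset (ℤ × ℤ) := S.map antiEquiv.toEmbedding

theorem mem_antiReflect {S : Finset (ℤ × ℤ)} {p : ℤ × ℤ} :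
    p ∈ antiReflect S ↔ (-p.2, -p.1) ∈ S := by
  rw [antiReflect, Finset.mem_map_equiv]
  rfl

theorem antiReflect_antiReflect (S : Finset (ℤ × ℤ)) : antiReflect (antiReflect S) = S := by
  ext p
  simp [mem_antiReflect]

theorem IsFilling.antiReflect {n : ℕ} {S : Finset (ℤ × ℤ)} (h : IsFilling n S) :
    IsFilling n (antiReflect S) := by
  constructor
  · rintro ⟨x, y⟩ hp
    rw [mem_antiReflect] at hp
    have := h.box _ hp
    simp only [ne_eq, Prod.mk.injEq] at *
    omega
  · intro x hx hx'
    obtain ⟨y, hy, hu⟩ := h.row (-x) (by omega) (by omega)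
    refine ⟨-y, by simpa [mem_antiReflect] using hy, fun z hz => ?_⟩
    rw [← hu (-z) (by simpa [mem_antiReflect] using hz), neg_neg]
  · intro x hx hx'
    obtain ⟨y, hy, hu⟩ := h.col (-x) (by omega) (by omega)
    refine ⟨-y, by simpa [mem_antiReflect] using hy, fun z hz => ?_⟩
    rw [← hu (-z) (by simpa [mem_antiReflect] using hz), neg_neg]

theorem antiReflect_mem_fillings {n j : ℕ} {S : Finset (ℤ × ℤ)} (h : S ∈ fillings n j) :
    antiReflect S ∈ fillings n j :=
  ⟨h.1.antiReflect, by rw [antiReflect, Finset.card_map, h.2]⟩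

theorem containsSum_antiReflect {S : Finset (ℤ × ℤ)} :
    ContainsSum Desc Asc (antiReflect S) ↔ ContainsSum Asc Desc S := by
  constructor
  · rintro ⟨p, hp, q, hq, r, hr, s, hs, h⟩
    rw [mem_antiReflect] at hp hq hr hs
    -- The reflection reverses the order of an ascending pair but keeps the left-to-right order of a
    -- descending one.
    refine ⟨_, hs, _, hr, _, hp, _, hq, ?_⟩
    simp only [Asc, Desc] at *
    omega
  · rintro ⟨p, hp, q, hq, r, hr, s, hs, h⟩
    refine ⟨(-r.2, -r.1), by simpa [mem_antiReflect] using hr,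
      (-s.2, -s.1), by simpa [mem_antiReflect] using hs,
      (-q.2, -q.1), by simpa [mem_antiReflect] using hq,
      (-p.2, -p.1), by simpa [mem_antiReflect] using hp, ?_⟩
    simp only [Asc, Desc] at *
    omega

theorem ncard_avoidingFillings_desc_asc (n j : ℕ) :
    (avoidingFillings n j Desc Asc).ncard = (avoidingFillings n j Asc Desc).ncard := by
  symm
  refine Set.ncard_congr (fun S _ => antiReflect S) ?_ ?_ ?_
  · intro S hS
    exact ⟨antiReflect_mem_fillings hS.1, fun h => hS.2 (containsSum_antiReflect.1 h)⟩
  · intro S T _ _ h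
    rw [← antiReflect_antiReflect S, h, antiReflect_antiReflect]
  · intro S hS
    refine ⟨antiReflect S, ⟨antiReflect_mem_fillings hS.1, fun h => hS.2 ?_⟩,
      antiReflect_antiReflect S⟩
    rw [← antiReflect_antiReflect S]
    exact containsSum_antiReflect.2 h

theorem ncard_avoidingFillings_asc_asc (n j : ℕ) :
    (avoidingFillings n j Asc Asc).ncard = (avoidingFillings n j Desc Desc).ncard := by
  rw [ncard_avoidingFillings_asc_eq_desc, ncard_avoidingFillings_desc_asc,
    ncard_avoidingFillings_asc_eq_desc]

/-! ### Point counts of fillings and monotone matchings. -/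

theorem IsFilling.neg_or_pos {n : ℕ} {S : Finset (ℤ × ℤ)} (h : IsFilling n S) {x y : ℤ}
    (hp : (x, y) ∈ S) : x < 0 ∨ 0 < y := by
  have := h.box _ hp
  simp only [ne_eq, Prod.mk.injEq] at this
  omega

theorem IsFilling.eq_of_subset {n : ℕ} {S T : Finset (ℤ × ℤ)} (hS : IsFilling n S)
    (hT : IsFilling n T) (h : S ⊆ T) : S = T := by
  refine subset_antisymm h ?_
  rintro ⟨x, y⟩ hp
  rcases hT.neg_or_pos hp with hx | hy
  · obtain ⟨z, hz, -⟩ := hS.col x (hT.box _ hp).1 hx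
    rwa [hT.col_unique hx hp (h hz)]
  · obtain ⟨z, hz, -⟩ := hS.row y hy (hT.box _ hp).2.2.2.1
    rwa [hT.row_unique hy hp (h hz)]

theorem IsFilling.card_eq_add_col {n : ℕ} {S : Finset (ℤ × ℤ)} (h : IsFilling n S) :
    S.card = n + (S.filter fun p => p.1 = 0).card := by
  rw [← Finset.card_filter_add_card_filter_not (s := S) (fun p => p.1 = 0), add_comm]
  congr 1
  have : (Finset.Icc (-(n : ℤ)) (-1)).card = n := by simp
  rw [← this]
  refine Finset.card_bij (fun p _ => p.1) ?_ ?_ ?_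
  · intro p hp
    rw [Finset.mem_filter] at hp
    have := h.box p hp.1
    rw [Finset.mem_Icc]
    omega
  · rintro ⟨x, y⟩ hp ⟨x', y'⟩ hq e
    simp only [Finset.mem_filter] at hp hq e
    subst e
    have := h.box _ hp.1
    rw [h.col_unique (by omega) hp.1 hq.1]
  · intro x hx
    rw [Finset.mem_Icc] at hx
    obtain ⟨y, hy, -⟩ := h.col x hx.1 (by omega)
    exact ⟨(x, y), Finset.mem_filter.2 ⟨hy, by dsimp only; omega⟩, rfl⟩

theorem IsFilling.card_eq_add_row {n : ℕ} {S : Finset (ℤ × ℤ)} (h : IsFilling n S) :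
    S.card = n + (S.filter fun p => p.2 = 0).card := by
  rw [← Finset.card_filter_add_card_filter_not (s := S) (fun p => p.2 = 0), add_comm]
  congr 1
  have : (Finset.Icc (1 : ℤ) n).card = n := by simp
  rw [← this]
  refine Finset.card_bij (fun p _ => p.2) ?_ ?_ ?_
  · intro p hp
    rw [Finset.mem_filter] at hp
    have := h.box p hp.1
    rw [Finset.mem_Icc]
    omega
  · rintro ⟨x, y⟩ hp ⟨x', y'⟩ hq e
    simp only [Finset.mem_filter] at hp hq e
    subst e
    have := h.box _ hp.1
    rw [h.row_unique (by omega) hp.1 hq.1]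
  · intro y hy
    rw [Finset.mem_Icc] at hy
    obtain ⟨x, hx, -⟩ := h.row y (by omega) hy.2
    exact ⟨(x, y), Finset.mem_filter.2 ⟨hx, by dsimp only; omega⟩, rfl⟩

theorem exists_strictMonoOn_finset (I J : Finset ℤ) (h : I.card = J.card) :
    ∃ e : ℤ → ℤ, (∀ x ∈ I, e x ∈ J) ∧ ∀ x ∈ I, ∀ y ∈ I, x < y → e x < e y := by
  refine ⟨fun x => if hx : x ∈ I then
    J.orderEmbOfFin h.symm ((I.orderIsoOfFin rfl).symm ⟨x, hx⟩) else 0, ?_, ?_⟩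
  · intro x hx
    simp only [hx, dif_pos]
    exact Finset.orderEmbOfFin_mem _ _ _
  · intro x hx y hy hxy
    simp only [hx, hy, dif_pos]
    simpa using hxy

theorem exists_strictAntiOn_finset (I J : Finset ℤ) (h : I.card = J.card) :
    ∃ e : ℤ → ℤ, (∀ x ∈ I, e x ∈ J) ∧ ∀ x ∈ I, ∀ y ∈ I, x < y → e y < e x := by
  obtain ⟨e, he, hm⟩ := exists_strictMonoOn_finset I (J.map (Equiv.neg ℤ).toEmbedding)
    (by rw [Finset.card_map, h])
  refine ⟨fun x => -e x, fun x hx => ?_, fun x hx y hy hxy => neg_lt_neg (hm x hx y hy hxy)⟩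
  simpa [Finset.mem_map_equiv] using he x hx

namespace SignedIndex

variable {n : ℕ}

theorem bounds (i : SignedIndex n) : i.1 ≠ 0 ∧ -(n : ℤ) ≤ i.1 ∧ i.1 ≤ n :=
  ⟨i.2.1, abs_le.1 i.2.2⟩

theorem val_opp (i : SignedIndex n) : i.opp.1 = -i.1 := rfl

/-- The index with a given value. -/
def mk (x : ℤ) (h0 : x ≠ 0) (h1 : -(n : ℤ) ≤ x) (h2 : x ≤ n) : SignedIndex n :=
  ⟨x, h0, abs_le.2 ⟨h1, h2⟩⟩

instance : Finite (SignedIndex n) :=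
  Set.Finite.to_subtype (s := {i : ℤ | i ≠ 0 ∧ |i| ≤ (n : ℤ)})
    ((Set.finite_Icc (-(n : ℤ)) n).subset fun _ hi => abs_le.1 hi.2)

end SignedIndex

/-! ### Flattening a signed permutation. -/

section Signed

variable {n : ℕ}

/-- The point of the graph of `w` over `i`. -/
def graphPoint (w : Equiv.Perm (SignedIndex n)) (i : SignedIndex n) : ℤ × ℤ := (i.1, (w i).1)

open Classical in
/-- The graph of `w` without its south-east quadrant, where the south-west quadrant is flattened
onto the row `0` and the north-east quadrant onto the column `0`. -/
noncomputable def flatten (w : Equiv.Perm (SignedIndex n)) : Finset (ℤ × ℤ) :=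
  (Finset.Icc (-(n : ℤ)) 0 ×ˢ Finset.Icc (0 : ℤ) n).filter fun p : ℤ × ℤ =>
    p ≠ (0, 0) ∧ ∃ i : SignedIndex n, p = (min i.1 0, max (w i).1 0)

open Classical in
theorem mem_flatten {w : Equiv.Perm (SignedIndex n)} {p : ℤ × ℤ} :
    p ∈ flatten w ↔ p ≠ (0, 0) ∧ ∃ i, p = (min i.1 0, max (w i).1 0) := by
  rw [flatten, Finset.mem_filter, and_iff_right_iff_imp]
  rintro ⟨-, i, rfl⟩
  have := i.bounds
  have := (w i).bounds
  simp only [Finset.mem_product, Finset.mem_Icc]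
  omega

theorem mem_flatten_of_neg {w : Equiv.Perm (SignedIndex n)} {i : SignedIndex n} (hi : i.1 < 0) :
    (i.1, max (w i).1 0) ∈ flatten w :=
  mem_flatten.2 ⟨by simp [hi.ne], i, by rw [min_eq_left hi.le]⟩

theorem mem_flatten_of_pos {w : Equiv.Perm (SignedIndex n)} {i : SignedIndex n}
    (hi : 0 < (w i).1) : (min i.1 0, (w i).1) ∈ flatten w :=
  mem_flatten.2 ⟨by simp [hi.ne'], i, by rw [max_eq_left hi.le]⟩

theorem isFilling_flatten (w : Equiv.Perm (SignedIndex n)) : IsFilling n (flatten w) := by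
  constructor
  · intro p hp
    rw [mem_flatten] at hp
    obtain ⟨h0, i, rfl⟩ := hp
    have := i.bounds
    have := (w i).bounds
    refine ⟨?_, ?_, ?_, ?_, h0⟩ <;> dsimp only <;> omega
  · intro x hx hx'
    let i : SignedIndex n := SignedIndex.mk x hx'.ne hx (by omega)
    refine ⟨max (w i).1 0, mem_flatten_of_neg (i := i) hx', ?_⟩
    intro z hz
    obtain ⟨-, k, hk⟩ := mem_flatten.1 hz
    rw [Prod.mk.injEq] at hk
    have : k = i := Subtype.ext (by change k.1 = x; omega)
    rw [hk.2, this]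
  · intro y hy hy'
    let v : SignedIndex n := SignedIndex.mk y hy.ne' (by omega) hy'
    refine ⟨min (w.symm v).1 0, ?_, ?_⟩
    · have := mem_flatten_of_pos (w := w) (i := w.symm v) (by rwa [w.apply_symm_apply])
      rwa [w.apply_symm_apply] at this
    · intro z hz
      obtain ⟨-, k, hk⟩ := mem_flatten.1 hz
      rw [Prod.mk.injEq] at hk
      have : w k = v := Subtype.ext (by change (w k).1 = y; omega)
      rw [hk.1, ← this, w.symm_apply_apply]

theorem card_flatten (w : Equiv.Perm (SignedIndex n)) :
    (flatten w).card = n + numPosPos w := by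
  rw [(isFilling_flatten w).card_eq_add_col, numPosPos, ← Set.ncard_coe_finset]
  congr 1
  symm
  refine Set.ncard_congr (fun i _ => (0, (w i).1)) ?_ ?_ ?_
  · rintro i ⟨h1, h2⟩
    have := mem_flatten_of_pos h2
    rw [min_eq_right h1.le] at this
    simpa using this
  · intro i k _ _ h
    rw [Prod.mk.injEq] at h
    exact w.injective (Subtype.ext h.2)
  · rintro ⟨x, y⟩ hp
    simp only [Finset.coe_filter, Set.mem_ofPred_eq] at hp
    obtain ⟨hp, rfl⟩ := hp
    obtain ⟨h0, i, hi⟩ := mem_flatten.1 hp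
    simp only [Prod.mk.injEq, ne_eq, true_and] at hi h0
    have := i.bounds
    have := (w i).bounds
    refine ⟨i, ⟨by omega, by omega⟩, ?_⟩
    rw [Prod.mk.injEq]
    omega

theorem signed_apply_opp {w : Equiv.Perm (SignedIndex n)} (hw : w ∈ signedPerms n)
    (i : SignedIndex n) : (w i.opp).1 = -(w i).1 := by
  rw [show w i.opp = (w i).opp from hw i, SignedIndex.val_opp]

/-! ### Pattern avoidance read off the flattening. -/

/-- The graph of `w` has no `α`-pair in the north-east quadrant. -/
def NEAvoids (α : ℤ × ℤ → ℤ × ℤ → Prop) (w : Equiv.Perm (SignedIndex n)) : Prop :=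
  ∀ a b : SignedIndex n, 0 < a.1 → 0 < b.1 → 0 < (w a).1 → 0 < (w b).1 →
    ¬ α (graphPoint w a) (graphPoint w b)

/-- The graph of `w` contains an `α`-pair to the south-west of a `β`-pair. -/
def GraphContainsSum (α β : ℤ × ℤ → ℤ × ℤ → Prop) (w : Equiv.Perm (SignedIndex n)) : Prop :=
  ∃ a b c d : SignedIndex n, α (graphPoint w a) (graphPoint w b) ∧
    β (graphPoint w c) (graphPoint w d) ∧
    Asc (graphPoint w a) (graphPoint w c) ∧ Asc (graphPoint w a) (graphPoint w d) ∧
    Asc (graphPoint w b) (graphPoint w c) ∧ Asc (graphPoint w b) (graphPoint w d)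

theorem avoidsPattern1234_iff (w : Equiv.Perm (SignedIndex n)) :
    AvoidsPattern w pattern1234 ↔ ¬ GraphContainsSum Asc Asc w := by
  refine not_congr ⟨?_, ?_⟩
  · rintro ⟨a, ha, h⟩
    have lt : ∀ i k : Fin 4, i < k → Asc (graphPoint w (a i)) (graphPoint w (a k)) :=
      fun i k hik => ⟨ha hik, (h i k).2 hik⟩
    exact ⟨a 0, a 1, a 2, a 3, lt _ _ (by decide), lt _ _ (by decide), lt _ _ (by decide),
      lt _ _ (by decide), lt _ _ (by decide), lt _ _ (by decide)⟩
  · rintro ⟨a, b, c, d, h⟩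
    simp only [Asc, graphPoint] at h
    have hm : StrictMono ![a, b, c, d] := by
      rw [Fin.strictMono_iff_lt_succ]
      intro i
      rw [← Subtype.coe_lt_coe]
      fin_cases i
      exacts [h.1.1, h.2.2.2.2.1.1, h.2.1.1]
    have hw : StrictMono fun i => w (![a, b, c, d] i) := by
      rw [Fin.strictMono_iff_lt_succ]
      intro i
      rw [← Subtype.coe_lt_coe]
      fin_cases i
      exacts [h.1.2, h.2.2.2.2.1.2, h.2.1.2]
    exact ⟨_, hm, fun i k => hw.lt_iff_lt⟩

theorem avoidsPattern2143_iff (w : Equiv.Perm (SignedIndex n)) :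
    AvoidsPattern w pattern2143 ↔ ¬ GraphContainsSum Desc Desc w := by
  refine not_congr ⟨?_, ?_⟩
  · rintro ⟨a, ha, h⟩
    have asc : ∀ i k : Fin 4, i < k → pattern2143 i < pattern2143 k →
        Asc (graphPoint w (a i)) (graphPoint w (a k)) :=
      fun i k hik hp => ⟨ha hik, (h i k).2 hp⟩
    have desc : ∀ i k : Fin 4, i < k → pattern2143 k < pattern2143 i →
        Desc (graphPoint w (a i)) (graphPoint w (a k)) :=
      fun i k hik hp => ⟨ha hik, (h k i).2 hp⟩
    exact ⟨a 0, a 1, a 2, a 3, desc _ _ (by decide) (by decide), desc _ _ (by decide) (by decide),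
      asc _ _ (by decide) (by decide), asc _ _ (by decide) (by decide),
      asc _ _ (by decide) (by decide), asc _ _ (by decide) (by decide)⟩
  · rintro ⟨a, b, c, d, h⟩
    simp only [Asc, Desc, graphPoint] at h
    have hm : StrictMono ![a, b, c, d] := by
      rw [Fin.strictMono_iff_lt_succ]
      intro i
      rw [← Subtype.coe_lt_coe]
      fin_cases i
      exacts [h.1.1, h.2.2.2.2.1.1, h.2.1.1]
    -- The values increase in the order `b, a, d, c`; since the pattern is an involution, this gives
    -- the required equivalence.
    have hw : StrictMono fun i => w (![a, b, c, d] (pattern2143 i)) := by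
      rw [Fin.strictMono_iff_lt_succ]
      intro i
      rw [← Subtype.coe_lt_coe]
      fin_cases i
      exacts [h.1.2, h.2.2.2.1.2, h.2.1.2]
    refine ⟨_, hm, fun i k => ?_⟩
    have hinv : ∀ i, pattern2143 (pattern2143 i) = i := by decide
    have := hw.lt_iff_lt (a := pattern2143 i) (b := pattern2143 k)
    simpa only [hinv] using this

/-- Clamping by `min` and `max` is weakly monotone, so strict inequalities between clamped
coordinates already hold before clamping. -/
theorem graphContainsSum_of_flatten {α : ℤ × ℤ → ℤ × ℤ → Prop} (hα : α = Asc ∨ α = Desc)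
    {w : Equiv.Perm (SignedIndex n)} (h : ContainsSum α α (flatten w)) :
    GraphContainsSum α α w := by
  obtain ⟨p, hp, q, hq, r, hr, s, hs, h⟩ := h
  obtain ⟨-, a, rfl⟩ := mem_flatten.1 hp
  obtain ⟨-, b, rfl⟩ := mem_flatten.1 hq
  obtain ⟨-, c, rfl⟩ := mem_flatten.1 hr
  obtain ⟨-, d, rfl⟩ := mem_flatten.1 hs
  refine ⟨a, b, c, d, ?_⟩
  rcases hα with rfl | rfl <;> simp only [Asc, Desc, graphPoint] at h ⊢ <;> omega

theorem graphContainsSum_of_not_NEAvoids {α : ℤ × ℤ → ℤ × ℤ → Prop} (hα : α = Asc ∨ α = Desc)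
    {w : Equiv.Perm (SignedIndex n)} (hw : w ∈ signedPerms n) (h : ¬ NEAvoids α w) :
    GraphContainsSum α α w := by
  unfold NEAvoids at h
  push Not at h
  obtain ⟨a, b, ha, hb, hwa, hwb, h⟩ := h
  refine ⟨b.opp, a.opp, a, b, ?_⟩
  rcases hα with rfl | rfl <;>
    simp only [Asc, Desc, graphPoint, signed_apply_opp hw, SignedIndex.val_opp] at h ⊢ <;> omega

/-- By the half-turn, the south-west quadrant has no `α`-pair either. As `a` and `b` are negative,
one of their values is positive, which makes the values at `c` and `d` positive. Clamping then
preserves all strict inequalities of the occurrence. -/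
theorem containsSum_flatten_of_neg {α : ℤ × ℤ → ℤ × ℤ → Prop} (hα : α = Asc ∨ α = Desc)
    {w : Equiv.Perm (SignedIndex n)} (hw : w ∈ signedPerms n) (hne : NEAvoids α w)
    {a b c d : SignedIndex n} (hab : α (graphPoint w a) (graphPoint w b))
    (hcd : α (graphPoint w c) (graphPoint w d))
    (hac : Asc (graphPoint w a) (graphPoint w c)) (had : Asc (graphPoint w a) (graphPoint w d))
    (hbc : Asc (graphPoint w b) (graphPoint w c)) (hbd : Asc (graphPoint w b) (graphPoint w d))
    (hc : c.1 < 0) : ContainsSum α α (flatten w) := by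
  have h := hne b.opp a.opp
  have h1 := (w a).bounds
  have h2 := (w b).bounds
  have h3 := d.bounds
  have hpos : 0 < (w c).1 ∧ 0 < (w d).1 := by
    rcases hα with rfl | rfl <;>
      simp only [Asc, Desc, graphPoint, signed_apply_opp hw, SignedIndex.val_opp] at * <;> omega
  have hneg : a.1 < 0 ∧ b.1 < 0 := ⟨hac.1.trans hc, hbc.1.trans hc⟩
  refine ⟨_, mem_flatten_of_neg hneg.1, _, mem_flatten_of_neg hneg.2,
    _, mem_flatten_of_pos hpos.1, _, mem_flatten_of_pos hpos.2, ?_⟩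
  rcases hα with rfl | rfl <;>
    simp only [Asc, Desc, graphPoint, signed_apply_opp hw, SignedIndex.val_opp] at * <;> omega

theorem containsSum_flatten {α : ℤ × ℤ → ℤ × ℤ → Prop} (hα : α = Asc ∨ α = Desc)
    {w : Equiv.Perm (SignedIndex n)} (hw : w ∈ signedPerms n) (hne : NEAvoids α w)
    (h : GraphContainsSum α α w) : ContainsSum α α (flatten w) := by
  obtain ⟨a, b, c, d, hab, hcd, hac, had, hbc, hbd⟩ := h
  by_cases hc : c.1 < 0
  · exact containsSum_flatten_of_neg hα hw hne hab hcd hac had hbc hbd hc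
  have h := hne b.opp a.opp
  have h' := hne c d
  have h1 := (w a).bounds
  have h2 := (w b).bounds
  have h3 := c.bounds
  have h4 := (w c).bounds
  have h5 := (w d).bounds
  have h6 := b.bounds
  -- With `c` and `d` positive, one of their values is negative, hence so are the values at `a` and
  -- `b`. Thus `a` and `b` are not both negative, so `b` is positive, and the half-turn of the
  -- occurrence falls under the previous case.
  apply containsSum_flatten_of_neg hα hw hne (a := d.opp) (b := c.opp) (c := b.opp) (d := a.opp)
  all_goals
    rcases hα with rfl | rfl <;>
      simp only [Asc, Desc, graphPoint, signed_apply_opp hw, SignedIndex.val_opp] at * <;> omega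

theorem not_graphContainsSum_iff {α : ℤ × ℤ → ℤ × ℤ → Prop} (hα : α = Asc ∨ α = Desc)
    {w : Equiv.Perm (SignedIndex n)} (hw : w ∈ signedPerms n) :
    ¬ GraphContainsSum α α w ↔ NEAvoids α w ∧ ¬ ContainsSum α α (flatten w) := by
  constructor
  · intro h
    exact ⟨by_contra fun h' => h (graphContainsSum_of_not_NEAvoids hα hw h'),
      fun h' => h (graphContainsSum_of_flatten hα h')⟩
  · rintro ⟨hne, h⟩ h'
    exact h (containsSum_flatten hα hw hne h')

/-! ### Flattening as a bijection. -/

theorem flatten_injOn {α : ℤ × ℤ → ℤ × ℤ → Prop} (hα : α = Asc ∨ α = Desc)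
    {w v : Equiv.Perm (SignedIndex n)} (hw : w ∈ signedPerms n) (hv : v ∈ signedPerms n)
    (hw' : NEAvoids α w) (hv' : NEAvoids α v) (h : flatten w = flatten v) : w = v := by
  have hmax : ∀ i : SignedIndex n, i.1 < 0 → max (w i).1 0 = max (v i).1 0 := fun i hi =>
    (isFilling_flatten w).col_unique hi (mem_flatten_of_neg hi) (h ▸ mem_flatten_of_neg hi)
  let I := {i : SignedIndex n // i.1 < 0 ∧ (w i).1 < 0}
  have hIv : ∀ i : I, (v i.1).1 < 0 := fun i => by
    have := hmax i.1 i.2.1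
    have := i.2.2
    have := (v i.1).bounds
    omega
  have hsub : ∀ {w v : Equiv.Perm (SignedIndex n)}, w ∈ signedPerms n → v ∈ signedPerms n →
      flatten w = flatten v → ∀ i : SignedIndex n, i.1 < 0 → (w i).1 < 0 →
      ∃ k : SignedIndex n, k.1 < 0 ∧ (v k).1 < 0 ∧ (v k).1 = (w i).1 := by
    intro w v hw hv h i hi hwi
    have hm : (min i.opp.1 0, (w i.opp).1) ∈ flatten w :=
      mem_flatten_of_pos (by rw [signed_apply_opp hw]; omega)
    rw [h, mem_flatten] at hm
    obtain ⟨-, k, hk⟩ := hm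
    rw [Prod.mk.injEq, signed_apply_opp hw, SignedIndex.val_opp] at hk
    have := k.bounds
    refine ⟨k.opp, ?_⟩
    rw [signed_apply_opp hv, SignedIndex.val_opp]
    omega
  -- Column `0` of the flattening records the negatives of the south-west values. A strictly
  -- monotone sequence is determined by its range.
  have hrange : Set.range (fun i : I => (w i.1).1) = Set.range (fun i : I => (v i.1).1) := by
    ext y
    constructor
    · rintro ⟨i, rfl⟩
      obtain ⟨k, hk, hk', e⟩ := hsub hw hv h i.1 i.2.1 i.2.2
      refine ⟨⟨k, hk, ?_⟩, e⟩
      have := hmax k hk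
      have := (w k).bounds
      omega
    · rintro ⟨i, rfl⟩
      obtain ⟨k, hk, hk', e⟩ := hsub hv hw h.symm i.1 i.2.1 (hIv i)
      exact ⟨⟨k, hk, hk'⟩, e⟩
  have hne : ∀ (u : Equiv.Perm (SignedIndex n)) (i k : I), i < k → (u i.1).1 ≠ (u k.1).1 :=
    fun u i k hik e => hik.ne (Subtype.ext (u.injective (Subtype.ext e)))
  have hfun : (fun i : I => (w i.1).1) = fun i : I => (v i.1).1 := by
    rcases hα with rfl | rfl
    · have anti : ∀ u : Equiv.Perm (SignedIndex n), u ∈ signedPerms n → NEAvoids Asc u →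
          (∀ i : I, (u i.1).1 < 0) → StrictMono fun i : I => OrderDual.toDual (u i.1).1 := by
        intro u hu hu' hneg i k hik
        rw [OrderDual.toDual_lt_toDual]
        have h1 := hu' k.1.opp i.1.opp
        have h2 := hneg i
        have h3 := hneg k
        have h4 := hne u i k hik
        have h5 : i.1.1 < k.1.1 := hik
        have h6 := i.2.1
        have h7 := k.2.1
        simp only [Asc, graphPoint, signed_apply_opp hu, SignedIndex.val_opp] at *
        omega
      have := ((anti w hw hw' fun i => i.2.2).range_inj (anti v hv hv' hIv)).1 hrange
      exact this
    · have mono : ∀ u : Equiv.Perm (SignedIndex n), u ∈ signedPerms n → NEAvoids Desc u →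
          (∀ i : I, (u i.1).1 < 0) → StrictMono fun i : I => (u i.1).1 := by
        intro u hu hu' hneg i k hik
        have h1 := hu' k.1.opp i.1.opp
        have h2 := hneg i
        have h3 := hneg k
        have h4 := hne u i k hik
        have h5 : i.1.1 < k.1.1 := hik
        have h6 := i.2.1
        have h7 := k.2.1
        simp only [Desc, graphPoint, signed_apply_opp hu, SignedIndex.val_opp] at *
        omega
      exact ((mono w hw hw' fun i => i.2.2).range_inj (mono v hv hv' hIv)).1 hrange
  have hneg : ∀ i : SignedIndex n, i.1 < 0 → (w i).1 = (v i).1 := by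
    intro i hi
    by_cases hwi : (w i).1 < 0
    · exact congrFun hfun ⟨i, hi, hwi⟩
    · have := hmax i hi
      have := (w i).bounds
      omega
  ext i
  rcases lt_or_ge i.1 0 with hi | hi
  · exact hneg i hi
  · have hi' := hneg i.opp (by have := i.bounds; rw [SignedIndex.val_opp]; omega)
    rw [signed_apply_opp hw, signed_apply_opp hv] at hi'
    omega

/-- An injective matching `e` of the row-`0` points with the column-`0` points is all that is needed
to undo the flattening: a column `x` with its point in row `0` receives the value `-e x`. -/
theorem exists_flatten_eq {S : Finset (ℤ × ℤ)} (hS : IsFilling n S) (e : ℤ → ℤ)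
    (he : ∀ x, (x, 0) ∈ S → (0, e x) ∈ S)
    (hinj : ∀ x, (x, 0) ∈ S → ∀ y, (y, 0) ∈ S → e x = e y → x = y) :
    ∃ w ∈ signedPerms n, flatten w = S ∧ ∀ a : SignedIndex n, 0 < a.1 → 0 < (w a).1 →
      (-a.1, 0) ∈ S ∧ (w a).1 = e (-a.1) := by
  have hex : ∀ x : ℤ, ∃ g : ℤ, -(n : ℤ) ≤ x → x < 0 →
      ((0 < g ∧ (x, g) ∈ S) ∨ (g < 0 ∧ (x, 0) ∈ S ∧ (0, -g) ∈ S ∧ -g = e x)) := by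
    intro x
    by_cases hx : -(n : ℤ) ≤ x ∧ x < 0
    · obtain ⟨y, hy, -⟩ := hS.col x hx.1 hx.2
      rcases (hS.box _ hy).2.2.1.eq_or_lt with h0 | h0
      · change 0 = y at h0
        subst h0
        have h1 := he x hy
        have h2 := hS.neg_or_pos h1
        refine ⟨-e x, fun _ _ => Or.inr ⟨by omega, hy, ?_, by omega⟩⟩
        rwa [neg_neg]
      · exact ⟨y, fun _ _ => Or.inl ⟨h0, hy⟩⟩
    · exact ⟨0, fun h h' => absurd ⟨h, h'⟩ hx⟩
  choose g hg using hex
  have hgb : ∀ x, -(n : ℤ) ≤ x → x < 0 → g x ≠ 0 ∧ -(n : ℤ) ≤ g x ∧ g x ≤ n := by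
    intro x hx hx'
    rcases hg x hx hx' with ⟨h1, h2⟩ | ⟨h1, -, h2, -⟩
    all_goals
      have := hS.box _ h2
      dsimp only at this
      omega
  have hginj : ∀ x y, -(n : ℤ) ≤ x → x < 0 → -(n : ℤ) ≤ y → y < 0 →
      (g x = g y ∨ g x = -g y) → x = y := by
    intro x y hx hx' hy hy' hxy
    rcases hg x hx hx' with ⟨h1, h2⟩ | ⟨h1, h2, h3, h4⟩ <;>
    rcases hg y hy hy' with ⟨k1, k2⟩ | ⟨k1, k2, k3, k4⟩
    · have : g x = g y := by omega
      exact hS.row_unique h1 h2 (this ▸ k2)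
    · have : g x = -g y := by omega
      exact absurd (hS.row_unique h1 h2 (this ▸ k3)) hx'.ne
    · have : g y = -g x := by omega
      exact absurd (hS.row_unique k1 k2 (this ▸ h3)) hy'.ne
    · exact hinj x h2 y k2 (by omega)
  let f : SignedIndex n → SignedIndex n := fun i =>
    if hi : i.1 < 0 then
      SignedIndex.mk (g i.1) (hgb _ i.bounds.2.1 hi).1 (hgb _ i.bounds.2.1 hi).2.1
        (hgb _ i.bounds.2.1 hi).2.2
    else
      SignedIndex.opp (SignedIndex.mk (g (-i.1))
        (hgb _ (by have := i.bounds; omega) (by have := i.bounds; omega)).1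
        (hgb _ (by have := i.bounds; omega) (by have := i.bounds; omega)).2.1
        (hgb _ (by have := i.bounds; omega) (by have := i.bounds; omega)).2.2)
  have hfneg : ∀ i : SignedIndex n, i.1 < 0 → (f i).1 = g i.1 := by
    intro i hi
    simp only [f, dif_pos hi]
    rfl
  have hfpos : ∀ i : SignedIndex n, 0 < i.1 → (f i).1 = -g (-i.1) := by
    intro i hi
    simp only [f, dif_neg hi.not_gt]
    rfl
  have hfinj : Function.Injective f := by
    intro i k hik
    have hik' : (f i).1 = (f k).1 := by rw [hik]
    have bi := i.bounds
    have bk := k.bounds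
    apply Subtype.ext
    rcases lt_or_gt_of_ne bi.1 with hi | hi <;> rcases lt_or_gt_of_ne bk.1 with hk | hk
    · rw [hfneg i hi, hfneg k hk] at hik'
      exact hginj _ _ bi.2.1 hi bk.2.1 hk (Or.inl hik')
    · rw [hfneg i hi, hfpos k hk] at hik'
      have := hginj i.1 (-k.1) bi.2.1 hi (by omega) (by omega) (Or.inr hik')
      rw [this] at hik'
      have := hgb (-k.1) (by omega) (by omega)
      omega
    · rw [hfpos i hi, hfneg k hk] at hik'
      have := hginj k.1 (-i.1) bk.2.1 hk (by omega) (by omega) (Or.inr hik'.symm)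
      rw [this] at hik'
      have := hgb (-i.1) (by omega) (by omega)
      omega
    · rw [hfpos i hi, hfpos k hk] at hik'
      have := hginj (-i.1) (-k.1) (by omega) (by omega) (by omega) (by omega)
        (Or.inl (by omega))
      omega
  let w : Equiv.Perm (SignedIndex n) :=
    Equiv.ofBijective f (Finite.injective_iff_bijective.1 hfinj)
  have hwf : ∀ i, w i = f i := fun _ => rfl
  refine ⟨w, ?_, ?_, ?_⟩
  · intro i
    apply Subtype.ext
    rw [SignedIndex.val_opp, hwf, hwf]
    rcases lt_or_gt_of_ne i.bounds.1 with hi | hi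
    · rw [hfneg i hi, hfpos i.opp (by rw [SignedIndex.val_opp]; omega), SignedIndex.val_opp,
        neg_neg]
    · rw [hfpos i hi, hfneg i.opp (by rw [SignedIndex.val_opp]; omega), SignedIndex.val_opp,
        neg_neg]
  -- Nested fillings coincide, so one inclusion is enough.
  · refine (isFilling_flatten w).eq_of_subset hS ?_
    intro p hp
    obtain ⟨h0, i, rfl⟩ := mem_flatten.1 hp
    rw [hwf] at h0 ⊢
    have bi := i.bounds
    rcases lt_or_gt_of_ne bi.1 with hi | hi
    · rw [min_eq_left hi.le, hfneg i hi]
      rcases hg i.1 bi.2.1 hi with ⟨h1, h2⟩ | ⟨h1, h2, -⟩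
      · rwa [max_eq_left h1.le]
      · rwa [max_eq_right h1.le]
    · rw [min_eq_right hi.le, hfpos i hi] at h0 ⊢
      rcases hg (-i.1) (by omega) (by omega) with ⟨h1, h2⟩ | ⟨h1, -, h2, -⟩
      -- South-east points collapse to the excluded corner.
      · exact absurd (by rw [max_eq_right (by omega)]) h0
      · rwa [max_eq_left (by omega)]
  · intro a ha hwa
    have ba := a.bounds
    rw [hwf, hfpos a ha] at hwa ⊢
    rcases hg (-a.1) (by omega) (by omega) with ⟨h1, h2⟩ | ⟨h1, h2, -, h3⟩
    · omega
    · exact ⟨h2, h3⟩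

theorem exists_NEAvoids_flatten_eq {α : ℤ × ℤ → ℤ × ℤ → Prop} (hα : α = Asc ∨ α = Desc)
    {S : Finset (ℤ × ℤ)} (hS : IsFilling n S) :
    ∃ w ∈ signedPerms n, NEAvoids α w ∧ flatten w = S := by
  set I := (S.filter fun p => p.2 = 0).image Prod.fst with hI
  set J := (S.filter fun p => p.1 = 0).image Prod.snd with hJ
  have hcard : I.card = J.card := by
    rw [hI, hJ, Finset.card_image_of_injOn, Finset.card_image_of_injOn]
    · have h1 := hS.card_eq_add_col
      have h2 := hS.card_eq_add_row
      omega
    · rintro ⟨x, y⟩ hp ⟨x', y'⟩ hq h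
      simp only [Finset.coe_filter, Set.mem_ofPred_eq] at hp hq h
      rw [hp.2, hq.2, h]
    · rintro ⟨x, y⟩ hp ⟨x', y'⟩ hq h
      simp only [Finset.coe_filter, Set.mem_ofPred_eq] at hp hq h
      rw [hp.2, hq.2, h]
  have memI : ∀ x, x ∈ I ↔ (x, 0) ∈ S := fun x => by simp [hI]
  have memJ : ∀ y, y ∈ J ↔ (0, y) ∈ S := fun y => by simp [hJ]
  rcases hα with rfl | rfl
  -- Since `w a = e (-a)` in the north-east quadrant, an increasing `e` makes that quadrant
  -- decreasing.
  · obtain ⟨e, he, hm⟩ := exists_strictMonoOn_finset I J hcard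
    simp only [memI, memJ] at he hm
    obtain ⟨w, hw, hwS, h⟩ := exists_flatten_eq hS e he fun x hx y hy hxy => by
      rcases lt_trichotomy x y with hl | hl | hl
      · exact absurd hxy (hm x hx y hy hl).ne
      · exact hl
      · exact absurd hxy (hm y hy x hx hl).ne'
    refine ⟨w, hw, ?_, hwS⟩
    rintro a b ha hb hwa hwb ⟨h1, h2⟩
    simp only [graphPoint] at h1 h2
    obtain ⟨k1, k2⟩ := h a ha hwa
    obtain ⟨k3, k4⟩ := h b hb hwb
    have := hm _ k3 _ k1 (by omega)
    omega
  · obtain ⟨e, he, hm⟩ := exists_strictAntiOn_finset I J hcard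
    simp only [memI, memJ] at he hm
    obtain ⟨w, hw, hwS, h⟩ := exists_flatten_eq hS e he fun x hx y hy hxy => by
      rcases lt_trichotomy x y with hl | hl | hl
      · exact absurd hxy (hm x hx y hy hl).ne'
      · exact hl
      · exact absurd hxy (hm y hy x hx hl).ne
    refine ⟨w, hw, ?_, hwS⟩
    rintro a b ha hb hwa hwb ⟨h1, h2⟩
    simp only [graphPoint] at h1 h2
    obtain ⟨k1, k2⟩ := h a ha hwa
    obtain ⟨k3, k4⟩ := h b hb hwb
    have := hm _ k3 _ k1 (by omega)
    omega

theorem ncard_avoidingSignedPerms_eq {k : ℕ} (j : ℕ) {α : ℤ × ℤ → ℤ × ℤ → Prop}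
    (hα : α = Asc ∨ α = Desc) (π : Equiv.Perm (Fin k))
    (hπ : ∀ w : Equiv.Perm (SignedIndex n), AvoidsPattern w π ↔ ¬ GraphContainsSum α α w) :
    (avoidingSignedPerms n j π).ncard = (avoidingFillings n j α α).ncard := by
  refine Set.ncard_congr (fun w _ => flatten w) ?_ ?_ ?_
  · rintro w ⟨hw, hav, hj⟩
    rw [hπ, not_graphContainsSum_iff hα hw] at hav
    exact ⟨⟨isFilling_flatten w, by rw [card_flatten, hj]⟩, hav.2⟩
  · rintro w v ⟨hw, hwa, -⟩ ⟨hv, hva, -⟩ h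
    rw [hπ, not_graphContainsSum_iff hα hw] at hwa
    rw [hπ, not_graphContainsSum_iff hα hv] at hva
    exact flatten_injOn hα hw hv hwa.1 hva.1 h
  · rintro S ⟨⟨hS, hc⟩, hav⟩
    obtain ⟨w, hw, hne, rfl⟩ := exists_NEAvoids_flatten_eq hα hS
    refine ⟨w, ⟨hw, ?_, ?_⟩, rfl⟩
    · rw [hπ, not_graphContainsSum_iff hα hw]
      exact ⟨hne, hav⟩
    · rw [card_flatten] at hc
      omega

end Signed

theorem theorem1 (n j : ℕ) (hj : j ≤ n) :
    (avoidingSignedPerms n j pattern1234).ncard = (avoidingSignedPerms n j pattern2143).ncard := by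
  rw [ncard_avoidingSignedPerms_eq j (Or.inl rfl) _ avoidsPattern1234_iff,
    ncard_avoidingSignedPerms_eq j (Or.inr rfl) _ avoidsPattern2143_iff,
    ncard_avoidingFillings_asc_asc]
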